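/- Let $\Bbbk$ be a field, let $G$ be a finite simple graph with vertex set $V(G)$, and let $S=\Bbbk[x_v : v\in V(G)]$. For a graph $\Gamma$ with $V(\Gamma)\subseteq V(G)$ and $n\ge 1$, the $n$-th symbolic power of its edge ideal is the monomial ideal $I(\Gamma)^{(n)}=\bigcap_{C}\mathfrak p_C^{\,n}$ of $S$, where $C$ runs over the minimal vertex covers of $\Gamma$ and $\mathfrak p_C=(x_v : v\in C)$. For a monomial ideal $I\subseteq S$, let $\beta_{i,a}(I)$ (for $a\in\mathbb N^{V(G)}$) and $\beta_{i,j}(I)$ (for $j\in\mathbb N$) denote the number of summands $S(-a)$, respectively $S(-j)$, in homological degree $i$ of the minimal multigraded free resolution of $I$ over $S$, where for $S(-j)$ the multigrading is coarsened to the standard $\mathbb N$-grading. Let $\operatorname{reg} I=\sup\{\,j-i : \beta_{i,j}(I)\neq 0\,\}$, with $\operatorname{reg} 0=-\infty$. Let $H$ be an induced subgraph of $G$ and let $n\ge 1$ be an integer. Then 1. $\beta_{i,a}(I(H)^{(n)})\le \beta_{i,a}(I(G)^{(n)})$ for all $i\ge 0$ and $a\in\mathbb N^{V(G)}$, and $\beta_{i,j}(I(H)^{(n)})\le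 \beta_{i,j}(I(G)^{(n)})$ for all $i,j\ge 0$; 2. $\operatorname{reg} I(H)^{(n)}\le \operatorname{reg} I(G)^{(n)}$. -/

import Mathlib

noncomputable section

/-- The `n`-th symbolic power `I(G)^{(n)} = ⋂ 𝔭_C ^ n` of the edge ideal of `G`, an ideal of the
polynomial ring `k[V]`. Here `C` runs over the minimal vertex covers of `G` and `𝔭_C` is the prime
ideal generated by the variables in `C`. Isolated vertices lie in no minimal vertex cover. -/
def edgeIdealSymbolicPower (k : Type*) [Field k] {V : Type*} (G : SimpleGraph V) (n : ℕ) :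
    Ideal (MvPolynomial V k) :=
  ⨅ (C : Set V) (_ : Minimal G.IsVertexCover C),
    Ideal.span ((MvPolynomial.X : V → MvPolynomial V k) '' C) ^ n

/-- A minimal multigraded (that is, `ℕ^V`-graded) free resolution
`⋯ → F 2 → F 1 → F 0 → I → 0` of an ideal `I` of `S = k[V]`.
The module `F i = ⨁_b S(-deg i b)` is free of finite rank on generators `b : Fin (rank i)`, the
generator `b` being placed in multidegree `deg i b`. -/
structure MinimalMultigradedFreeResolution {k V : Type*} [Field k]
    (I : Ideal (MvPolynomial V k)) where
  /-- the rank of `F i` -/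
  rank : ℕ → ℕ
  /-- the multidegrees of the generators of `F i` -/
  deg : ∀ i, Fin (rank i) → V →₀ ℕ
  /-- the differential `F (i + 1) → F i` -/
  d : ∀ i, (Fin (rank (i + 1)) → MvPolynomial V k) →ₗ[MvPolynomial V k]
    (Fin (rank i) → MvPolynomial V k)
  /-- the augmentation `F 0 → I ⊆ S` -/
  aug : (Fin (rank 0) → MvPolynomial V k) →ₗ[MvPolynomial V k] MvPolynomial V k
  /-- The differentials preserve multidegrees: the matrix entry from the generator `b` to the
  generator `c` only involves monomials of multidegree `deg b - deg c`. -/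
  d_homogeneous : ∀ i b c, ∀ u ∈ (d i (Pi.single b 1) c).support, u + deg i c = deg (i + 1) b
  /-- The augmentation preserves multidegrees. -/
  aug_homogeneous : ∀ b, ∀ u ∈ (aug (Pi.single b 1)).support, u = deg 0 b
  range_aug : LinearMap.range aug = I
  exact_zero : LinearMap.ker aug = LinearMap.range (d 0)
  exact_succ : ∀ i, LinearMap.ker (d i) = LinearMap.range (d (i + 1))
  /-- Minimality: the image of `F (i + 1)` lies in `𝔪 F i`, where `𝔪` is generated by the
  variables. -/
  minimal : ∀ i x c, d i x c ∈ Ideal.span (Set.range (MvPolynomial.X : V → MvPolynomial V k))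

open Classical in
/-- The multigraded Betti number `β_{i,a}(I)` of a monomial ideal `I`: the number of summands
`S(-a)` in homological degree `i` of a minimal multigraded free resolution of `I`. Such a
resolution exists for every monomial ideal in finitely many variables and is unique up to
isomorphism. (The value is `0` for an ideal without such a resolution.) -/
def multigradedBetti {k V : Type*} [Field k] (I : Ideal (MvPolynomial V k)) (i : ℕ)
    (a : V →₀ ℕ) : ℕ :=
  if h : Nonempty (MinimalMultigradedFreeResolution I) then
    Fintype.card {b : Fin (h.some.rank i) // h.some.deg i b = a}
  else 0

open Classical in
/-- The graded Betti number `β_{i,j}(I)` of a monomial ideal `I`: the number of summands `S(-j)`,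
for the standard `ℕ`-grading, in homological degree `i` of a minimal multigraded free resolution
of `I`. -/
def gradedBetti {k V : Type*} [Field k] (I : Ideal (MvPolynomial V k)) (i j : ℕ) : ℕ :=
  if h : Nonempty (MinimalMultigradedFreeResolution I) then
    Fintype.card {b : Fin (h.some.rank i) // (h.some.deg i b).degree = j}
  else 0

/-- The Castelnuovo-Mumford regularity `reg I = sup {j - i | β_{i,j}(I) ≠ 0}` of a monomial ideal,
as an extended integer; `reg 0 = ⊥ = -∞`. -/
def castelnuovoMumfordReg {k V : Type*} [Field k] (I : Ideal (MvPolynomial V k)) :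
    WithBot (WithTop ℤ) :=
  ⨆ (i : ℕ) (j : ℕ) (_ : gradedBetti I i j ≠ 0), (((j : ℤ) - (i : ℤ) : ℤ) : WithTop ℤ)

end

/-! The proof restricts a resolution of `I(G)^(n)` to the multidegrees supported on `V(H)`. Let `ρ`
truncate an exponent vector to `V(H)`. It is monotone, `ρ a ≤ a`, and its fixed points form a lower
set. The combinatorial input is that `x^u` lies in `I(H)^(n)` iff `x^(ρ u)` lies in `I(G)^(n)`
(`monomial_mem_edgeIdealSymbolicPower_spanningCoe_iff`): vertex covers of `H` are exactly the traces
on `V(H)` of vertex covers of `G`.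

The degree `a` part of a graded free module is the span of the generators of degree at most `a`, and
a homogeneous map is a scalar matrix respecting these strands. Keep only the generators of a
resolution of `I(G)^(n)` whose degrees are fixed by `ρ`. The strand of degree `a` of what remains is
the old strand of degree `ρ a`, so exactness is inherited and the result resolves `I(H)^(n)`
(`StrandResolution.restrict`). By the comparison theorem, a minimal resolution has at most as many
generators in each degree as any other (`StrandResolution.card_fiber_le`), so minimality of the
restriction is not needed.

Since the Betti numbers default to `0` without a resolution, existence for `I(G)^(n)` has to be
proved; it follows from Dickson's lemma in the form that `ℕ^V` is well-quasi-ordered. The graded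
inequality is the multigraded one summed over degrees, and the regularity inequality follows from
it. -/

/-! ### Poset-graded free modules as scalar matrices. -/

section StrandAlgebra

variable {k : Type*} [Field k] {P : Type*} [PartialOrder P]

/-- The vectors of `k^ι` supported on the indices of degree at most `a`; this is the strand of
degree `a` of the free `P`-graded module with generators of degrees `deg`. -/
def strandBelow (k : Type*) [Field k] {ι : Type*} (deg : ι → P) (a : P) :
    Submodule k (ι → k) where
  carrier := {v | ∀ b, v b ≠ 0 → deg b ≤ a}
  zero_mem' := fun b hb => absurd rfl hb
  add_mem' := by
    intro v w hv hw b hb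
    by_cases h : v b = 0
    · refine hw b fun h' => hb ?_
      simp [h, h']
    · exact hv b h
  smul_mem' := by
    intro c v hv b hb
    refine hv b fun h => hb ?_
    simp [h]

lemma strandBelow_mono {ι : Type*} (deg : ι → P) : Monotone (strandBelow k deg) :=
  fun _ _ hab _ hv b hb => (hv b hb).trans hab

lemma single_mem_strandBelow {ι : Type*} [DecidableEq ι] {deg : ι → P} {a : P} {b : ι}
    (h : deg b ≤ a) (x : k) : (Pi.single b x : ι → k) ∈ strandBelow k deg a := by
  intro c hc
  by_cases hcb : c = b
  · exact hcb ▸ h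
  · exact absurd (Pi.single_eq_of_ne (M := fun _ => k) hcb x) hc

lemma LinearMap.apply_eq_sum_smul_single {R ι X : Type*} [CommSemiring R] [Fintype ι]
    [DecidableEq ι] [AddCommMonoid X] [Module R X] (f : (ι → R) →ₗ[R] X) (v : ι → R) :
    f v = ∑ b, v b • f (Pi.single b 1) := by
  conv_lhs => rw [pi_eq_sum_univ' v]
  rw [map_sum]
  refine Finset.sum_congr rfl fun b _ => ?_
  rw [map_smul]

/-- A linear map between free `P`-graded modules, given by a scalar matrix, that preserves
strands. -/
def PreservesStrands {ι κ : Type*} (deg : ι → P) (deg' : κ → P) (f : (ι → k) →ₗ[k] (κ → k)) :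
    Prop :=
  ∀ a, ∀ v ∈ strandBelow k deg a, f v ∈ strandBelow k deg' a

/-- The generators occurring in `v` have degrees strictly below `a`, and `f` cannot raise degrees.
-/
lemma PreservesStrands.apply_eq_zero {ι κ : Type*} [Finite ι] {deg : ι → P} {deg' : κ → P}
    {f : (ι → k) →ₗ[k] (κ → k)} (hf : PreservesStrands deg deg' f) {a : P} {v : ι → k}
    (hv : v ∈ strandBelow k deg a) (h0 : ∀ b, deg b = a → v b = 0) {c : κ} (hc : deg' c = a) :
    f v c = 0 := by
  classical
  have := Fintype.ofFinite ι
  rw [LinearMap.apply_eq_sum_smul_single f v, Finset.sum_apply]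
  refine Finset.sum_eq_zero fun b _ => ?_
  by_cases hb : v b = 0
  · simp [hb]
  by_cases hfb : f (Pi.single b 1) c = 0
  · simp [hfb]
  refine absurd (h0 b (le_antisymm (hv b hb) ?_)) hb
  exact hc ▸ hf (deg b) _ (single_mem_strandBelow le_rfl 1) c hfb

/-- Graded free modules are projective: lift each generator within its own degree and extend
linearly. -/
lemma exists_lift_preservesStrands {ι κ X : Type*} [Finite ι] [AddCommGroup X] [Module k X]
    (deg : ι → P) (deg' : κ → P) (D : (κ → k) →ₗ[k] X) (φ : (ι → k) →ₗ[k] X)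
    (h : ∀ a, ∀ v ∈ strandBelow k deg a, ∃ w ∈ strandBelow k deg' a, D w = φ v) :
    ∃ f : (ι → k) →ₗ[k] (κ → k), PreservesStrands deg deg' f ∧ ∀ v, D (f v) = φ v := by
  classical
  have := Fintype.ofFinite ι
  choose w hw hDw using fun b => h (deg b) (Pi.single b 1) (single_mem_strandBelow le_rfl 1)
  refine ⟨Fintype.linearCombination k w, fun a v hv => ?_, fun v => ?_⟩
  · rw [Fintype.linearCombination_apply]
    refine Submodule.sum_mem _ fun b _ => ?_
    by_cases hb : v b = 0
    · simp [hb]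
    · exact Submodule.smul_mem _ _ (strandBelow_mono deg' (hv b hb) (hw b))
  · rw [Fintype.linearCombination_apply, map_sum, LinearMap.apply_eq_sum_smul_single φ v]
    exact Finset.sum_congr rfl fun b _ => by rw [map_smul, hDw]

/-- A free resolution, by finitely generated free `P`-graded modules, of the `P`-graded module
which is `k` in the degrees in `U` and zero elsewhere, in terms of the scalar matrices of its
differentials. -/
structure StrandResolution (k : Type*) [Field k] {P : Type*} [PartialOrder P] (U : Set P) where
  ι : ℕ → Type
  finite : ∀ i, Finite (ι i)
  deg : ∀ i, ι i → P
  d : ∀ i, (ι (i + 1) → k) →ₗ[k] (ι i → k)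
  ε : (ι 0 → k) →ₗ[k] k
  d_preserves : ∀ i, PreservesStrands (deg (i + 1)) (deg i) (d i)
  ε_eq_zero : ∀ a ∉ U, ∀ v ∈ strandBelow k (deg 0) a, ε v = 0
  ε_surj : ∀ a ∈ U, ∃ v ∈ strandBelow k (deg 0) a, ε v = 1
  ε_d : ∀ w, ε (d 0 w) = 0
  d_d : ∀ i w, d i (d (i + 1) w) = 0
  exact_zero : ∀ a, ∀ v ∈ strandBelow k (deg 0) a, ε v = 0 →
    ∃ w ∈ strandBelow k (deg 1) a, d 0 w = v
  exact_succ : ∀ i a, ∀ v ∈ strandBelow k (deg (i + 1)) a, d i v = 0 →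
    ∃ w ∈ strandBelow k (deg (i + 2)) a, d (i + 1) w = v

/-! ### Comparison and restriction of resolutions. -/

namespace StrandResolution

variable {U : Set P}

attribute [instance] StrandResolution.finite

/-- The cycles of a resolution in homological degree `i`. -/
def cycles (F : StrandResolution k U) : ∀ i, Submodule k (F.ι i → k)
  | 0 => LinearMap.ker F.ε
  | i + 1 => LinearMap.ker (F.d i)

lemma exists_d_eq (F : StrandResolution k U) {i : ℕ} {a : P} {v : F.ι i → k}
    (hv : v ∈ strandBelow k (F.deg i) a) (hc : v ∈ F.cycles i) :
    ∃ w ∈ strandBelow k (F.deg (i + 1)) a, F.d i w = v := by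
  cases i with
  | zero => exact F.exact_zero a v hv hc
  | succ i => exact F.exact_succ i a v hv hc

/-- A resolution is minimal if no differential has a nonzero entry between generators of the same
degree. -/
def IsMinimal (F : StrandResolution k U) : Prop :=
  ∀ i a, ∀ v ∈ strandBelow k (F.deg (i + 1)) a, ∀ c, F.deg i c = a → F.d i v c = 0

lemma exists_augmentation_lift (F F' : StrandResolution k U) :
    ∃ f : (F.ι 0 → k) →ₗ[k] (F'.ι 0 → k), PreservesStrands (F.deg 0) (F'.deg 0) f ∧
      ∀ v, F'.ε (f v) = F.ε v := by
  refine exists_lift_preservesStrands _ _ _ _ fun a v hv => ?_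
  by_cases ha : a ∈ U
  · obtain ⟨w, hw, hw1⟩ := F'.ε_surj a ha
    exact ⟨F.ε v • w, Submodule.smul_mem _ _ hw, by simp [hw1]⟩
  · exact ⟨0, Submodule.zero_mem _, by simp [F.ε_eq_zero a ha v hv]⟩

lemma exists_lift_succ (F F' : StrandResolution k U) (i : ℕ)
    (f : (F.ι i → k) →ₗ[k] (F'.ι i → k)) (hf : PreservesStrands (F.deg i) (F'.deg i) f)
    (hfd : ∀ w, f (F.d i w) ∈ F'.cycles i) :
    ∃ f' : (F.ι (i + 1) → k) →ₗ[k] (F'.ι (i + 1) → k),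
      PreservesStrands (F.deg (i + 1)) (F'.deg (i + 1)) f' ∧
      (∀ v, F'.d i (f' v) = f (F.d i v)) ∧ ∀ w, f' (F.d (i + 1) w) ∈ F'.cycles (i + 1) := by
  obtain ⟨f', hf', h⟩ := exists_lift_preservesStrands (F.deg (i + 1)) (F'.deg (i + 1)) (F'.d i)
    (f ∘ₗ F.d i) fun a v hv => F'.exists_d_eq (hf a _ (F.d_preserves i a v hv)) (hfd v)
  refine ⟨f', hf', h, fun w => ?_⟩
  change F'.d i _ = 0
  rw [h]
  simp [F.d_d]

/-- Comparison of a minimal resolution `F` with an arbitrary resolution `F'`: there are maps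
`f : F → F'` and `g : F' → F` such that `g ∘ f` is homotopic to the identity, hence is the identity
on the generators of any given degree modulo those of smaller degree. -/
lemma exists_comparison (F F' : StrandResolution k U) (hF : F.IsMinimal) (i : ℕ) :
    ∃ (f : (F.ι i → k) →ₗ[k] (F'.ι i → k)) (g : (F'.ι i → k) →ₗ[k] (F.ι i → k))
      (h : (F.ι i → k) →ₗ[k] (F.ι (i + 1) → k)),
      PreservesStrands (F.deg i) (F'.deg i) f ∧ PreservesStrands (F'.deg i) (F.deg i) g ∧
      PreservesStrands (F.deg i) (F.deg (i + 1)) h ∧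
      (∀ w, f (F.d i w) ∈ F'.cycles i) ∧ (∀ w, g (F'.d i w) ∈ F.cycles i) ∧
      -- The homotopy relation is recorded on boundaries only: there the term from the previous
      -- homotopy vanishes, so the induction carries a single `h`.
      (∀ w, g (f (F.d i w)) - F.d i w = F.d i (h (F.d i w))) ∧
      ∀ a, ∀ v ∈ strandBelow k (F.deg i) a, ∀ b, F.deg i b = a → g (f v) b = v b := by
  induction i with
  | zero =>
    obtain ⟨f, hf, hfε⟩ := F.exists_augmentation_lift F'
    obtain ⟨g, hg, hgε⟩ := F'.exists_augmentation_lift F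
    obtain ⟨h, hh, hdh⟩ := exists_lift_preservesStrands (F.deg 0) (F.deg 1) (F.d 0)
      (g ∘ₗ f - LinearMap.id) fun a v hv => F.exists_d_eq
        (Submodule.sub_mem _ (hg a _ (hf a v hv)) hv) (by
          change F.ε _ = 0
          simp [hfε, hgε])
    refine ⟨f, g, h, hf, hg, hh, fun w => ?_, fun w => ?_, fun w => ?_, fun a v hv b hb => ?_⟩
    · change F'.ε _ = 0
      rw [hfε, F.ε_d]
    · change F.ε _ = 0
      rw [hgε, F'.ε_d]
    · rw [hdh]
      rfl
    · have h1 := hF 0 a (h v) (hh a v hv) b hb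
      rw [hdh] at h1
      exact sub_eq_zero.mp h1
  | succ i ih =>
    obtain ⟨f₀, g₀, h₀, hf₀, hg₀, hh₀, hfc, hgc, hgf, -⟩ := ih
    obtain ⟨f, hf, hfd, hfc'⟩ := F.exists_lift_succ F' i f₀ hf₀ hfc
    obtain ⟨g, hg, hgd, hgc'⟩ := F'.exists_lift_succ F i g₀ hg₀ hgc
    obtain ⟨h, hh, hdh⟩ := exists_lift_preservesStrands (F.deg (i + 1)) (F.deg (i + 2))
      (F.d (i + 1)) (g ∘ₗ f - LinearMap.id - h₀ ∘ₗ F.d i) fun a v hv => F.exists_d_eq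
        (Submodule.sub_mem _ (Submodule.sub_mem _ (hg a _ (hf a v hv)) hv)
          (hh₀ a _ (F.d_preserves i a v hv))) (by
          change F.d i _ = 0
          simp only [LinearMap.sub_apply, LinearMap.comp_apply, LinearMap.id_apply, map_sub]
          rw [hgd, hfd, hgf, sub_self])
    refine ⟨f, g, h, hf, hg, hh, hfc', hgc', fun w => ?_, fun a v hv b hb => ?_⟩
    · rw [hdh]
      simp [F.d_d]
    · have h1 := hF (i + 1) a (h v) (hh a v hv) b hb
      rw [hdh] at h1
      -- By minimality `F.d i v` has no coordinate in degree `a`, so neither has its image under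
      -- `h₀`.
      have h2 := hh₀.apply_eq_zero (F.d_preserves i a v hv) (hF i a v hv) hb
      simp only [LinearMap.sub_apply, LinearMap.comp_apply, LinearMap.id_apply,
        Pi.sub_apply, h2, sub_zero] at h1
      exact sub_eq_zero.mp h1

/-- A minimal resolution has at most as many generators of each degree as any other resolution. -/
theorem card_fiber_le (F F' : StrandResolution k U) (hF : F.IsMinimal) (i : ℕ) (a : P) :
    Nat.card {b // F.deg i b = a} ≤ Nat.card {b // F'.deg i b = a} := by
  classical
  obtain ⟨f, g, -, hf, hg, -, -, -, -, hgf⟩ := F.exists_comparison F' hF i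
  have := Fintype.ofFinite (F.ι i)
  have := Fintype.ofFinite (F'.ι i)
  let e := Function.ExtendByZero.linearMap k (Subtype.val : {b // F.deg i b = a} → F.ι i)
  have he : ∀ v b, e v b.1 = v b := fun v b => Subtype.val_injective.extend_apply _ _ _
  have hbelow : ∀ v, e v ∈ strandBelow k (F.deg i) a := by
    intro v b hb
    by_contra hba
    refine hb (Function.extend_apply' _ _ _ ?_)
    rintro ⟨c, rfl⟩
    exact hba c.2.le
  let φ := LinearMap.funLeft k k (Subtype.val : {b // F'.deg i b = a} → F'.ι i) ∘ₗ f ∘ₗ e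
  -- `φ` is the degree `a` block of `f`. If it kills `v`, then `f (e v)` involves only generators of
  -- smaller degree, so `g (f (e v))` vanishes in degree `a`, where it agrees with `v`.
  have hφ : Function.Injective φ := by
    rw [injective_iff_map_eq_zero]
    intro v hv
    ext b
    rw [← he v b, ← hgf a _ (hbelow v) b b.2]
    exact hg.apply_eq_zero (hf a _ (hbelow v)) (fun c hc => congrFun hv ⟨c, hc⟩) b.2
  simpa [Nat.card_eq_fintype_card] using LinearMap.finrank_le_finrank_of_injective hφ

/-- The restriction of a resolution to the generators whose degree is fixed by an interior
operator `ρ`. It resolves the restriction of `U` along `ρ`. -/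
noncomputable def restrict (F : StrandResolution k U) (ρ : P → P) (hmono : Monotone ρ)
    (hle : ∀ a, ρ a ≤ a) (hlower : ∀ a b, a ≤ ρ b → ρ a = a) : StrandResolution k (ρ ⁻¹' U) := by
  let e (i : ℕ) := Function.ExtendByZero.linearMap k
    (Subtype.val : {b // ρ (F.deg i b) = F.deg i b} → F.ι i)
  let r (i : ℕ) := LinearMap.funLeft k k
    (Subtype.val : {b // ρ (F.deg i b) = F.deg i b} → F.ι i)
  let δ (i : ℕ) (b : {b // ρ (F.deg i b) = F.deg i b}) : P := F.deg i b.1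
  have he : ∀ i v b, e i v b.1 = v b := fun i v b => Subtype.val_injective.extend_apply _ _ _
  have he0 : ∀ i v b, ρ (F.deg i b) ≠ F.deg i b → e i v b = 0 := by
    intro i v b hb
    refine Function.extend_apply' _ _ _ ?_
    rintro ⟨c, rfl⟩
    exact hb c.2
  have hre : ∀ i v, r i (e i v) = v := fun i v => funext fun b => he i v b
  have her : ∀ i v, (∀ b, v b ≠ 0 → ρ (F.deg i b) = F.deg i b) → e i (r i v) = v := by
    intro i v hv
    ext b
    by_cases hb : ρ (F.deg i b) = F.deg i b
    · exact he i _ ⟨b, hb⟩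
    · rw [he0 i _ b hb]
      by_contra h
      exact hb (hv b (Ne.symm h))
  -- A kept generator of degree `c ≤ a` satisfies `c = ρ c ≤ ρ a`.
  have heb : ∀ i a v, v ∈ strandBelow k (δ i) a → e i v ∈ strandBelow k (F.deg i) (ρ a) := by
    intro i a v hv b hb
    by_cases hρ : ρ (F.deg i b) = F.deg i b
    · rw [← hρ]
      refine hmono (hv ⟨b, hρ⟩ ?_)
      rw [← he i v ⟨b, hρ⟩]
      exact hb
    · exact absurd (he0 i v b hρ) hb
  have hrb : ∀ i a v, v ∈ strandBelow k (F.deg i) (ρ a) → r i v ∈ strandBelow k (δ i) a :=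
    fun i a v hv b hb => (hv b.1 hb).trans (hle a)
  have hfix : ∀ i a v, v ∈ strandBelow k (F.deg i) (ρ a) → e i (r i v) = v :=
    fun i a v hv => her i v fun b hb => hlower _ _ (hv b hb)
  -- The kept generators span a subcomplex: the differential only reaches smaller degrees, and the
  -- fixed points of `ρ` form a lower set.
  have hder : ∀ i v, e i (r i (F.d i (e (i + 1) v))) = F.d i (e (i + 1) v) := by
    intro i v
    refine her i _ fun c hc => ?_
    classical
    have := Fintype.ofFinite (F.ι (i + 1))
    rw [LinearMap.apply_eq_sum_smul_single (F.d i), Finset.sum_apply] at hc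
    obtain ⟨b, -, hb⟩ := Finset.exists_ne_zero_of_sum_ne_zero hc
    simp only [Pi.smul_apply, smul_eq_mul, ne_eq, mul_eq_zero, not_or] at hb
    have hρ : ρ (F.deg (i + 1) b) = F.deg (i + 1) b := by
      by_contra h
      exact hb.1 (he0 _ _ _ h)
    refine hlower _ (F.deg (i + 1) b) (hρ.symm ▸ ?_)
    exact F.d_preserves i _ _ (single_mem_strandBelow le_rfl 1) c hb.2
  exact
    { ι := fun i => {b // ρ (F.deg i b) = F.deg i b}
      finite := fun i => inferInstance
      deg := δ
      d := fun i => r i ∘ₗ F.d i ∘ₗ e (i + 1)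
      ε := F.ε ∘ₗ e 0
      d_preserves := fun i a v hv =>
        hrb i a _ (F.d_preserves i _ _ (heb (i + 1) a v hv))
      ε_eq_zero := fun a ha v hv => F.ε_eq_zero (ρ a) ha _ (heb 0 a v hv)
      ε_surj := fun a ha => by
        obtain ⟨v, hv, hv1⟩ := F.ε_surj (ρ a) ha
        exact ⟨r 0 v, hrb 0 a v hv, by rw [LinearMap.comp_apply, hfix 0 a v hv, hv1]⟩
      ε_d := fun w => by
        simp only [LinearMap.comp_apply]
        rw [hder, F.ε_d]
      d_d := fun i w => by
        simp only [LinearMap.comp_apply]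
        rw [hder, F.d_d, map_zero]
      exact_zero := fun a v hv h0 => by
        obtain ⟨w, hw, hwv⟩ := F.exact_zero (ρ a) (e 0 v) (heb 0 a v hv) h0
        refine ⟨r 1 w, hrb 1 a w hw, ?_⟩
        simp only [LinearMap.comp_apply]
        rw [hfix 1 a w hw, hwv, hre]
      exact_succ := fun i a v hv h0 => by
        have h0' : F.d i (e (i + 1) v) = 0 := by
          rw [← hder]
          simp only [LinearMap.comp_apply] at h0
          rw [h0, map_zero]
        obtain ⟨w, hw, hwv⟩ := F.exact_succ i (ρ a) (e (i + 1) v) (heb (i + 1) a v hv) h0'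
        refine ⟨r (i + 2) w, hrb (i + 2) a w hw, ?_⟩
        simp only [LinearMap.comp_apply]
        rw [hfix (i + 2) a w hw, hwv, hre] }

lemma card_fiber_restrict_le (F : StrandResolution k U) (ρ : P → P) (hmono : Monotone ρ)
    (hle : ∀ a, ρ a ≤ a) (hlower : ∀ a b, a ≤ ρ b → ρ a = a) (i : ℕ) (a : P) :
    Nat.card {b // (F.restrict ρ hmono hle hlower).deg i b = a} ≤
      Nat.card {b // F.deg i b = a} :=
  Nat.card_le_card_of_injective
    (fun b : {b : {b // ρ (F.deg i b) = F.deg i b} // F.deg i b.1 = a} =>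
      (⟨b.1.1, b.2⟩ : {b // F.deg i b = a}))
    fun _ _ h => Subtype.ext (Subtype.ext (Subtype.mk.inj h))

end StrandResolution

end StrandAlgebra

/-! ### Existence of minimal resolutions over well-quasi-ordered degrees. -/

section StrandResolutionExistence

variable {k : Type*} [Field k] {P : Type*} [PartialOrder P]

/-- Infinitely many such degrees would contain a strictly increasing sequence by
well-quasi-ordering. The subspaces generated below its terms would then grow strictly forever inside
a finite-dimensional space. -/
lemma finite_setOf_not_le_iSup_lt [WellQuasiOrderedLE P] {M : Type*} [AddCommGroup M] [Module k M]
    [FiniteDimensional k M] (Z : P → Submodule k M) :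
    {a | ¬ Z a ≤ ⨆ a' < a, Z a'}.Finite := by
  by_contra hinf
  let s := Set.Infinite.natEmbedding _ hinf
  obtain ⟨g, hg⟩ := wellQuasiOrdered_le.exists_monotone_subseq fun n => (s n : P)
  refine not_strictMono_of_wellFoundedGT (fun n => ⨆ a' < (s (g n) : P), Z a')
    (strictMono_nat_of_lt_succ fun n => ?_)
  have hle : (s (g n) : P) < s (g (n + 1)) := by
    refine lt_of_le_of_ne (hg n (n + 1) n.le_succ) fun h => ?_
    exact n.succ_ne_self (g.injective (s.injective (Subtype.ext h))).symm
  refine lt_of_le_of_ne (iSup₂_le fun a h => le_iSup₂_of_le a (h.trans hle) le_rfl) fun h => ?_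
  refine (s (g n)).2 ?_
  rw [h]
  exact le_iSup₂_of_le (s (g n) : P) hle le_rfl

/-- A minimal cover of an increasing family of subspaces of a finite-dimensional space by a
finitely generated free `P`-graded module. -/
lemma exists_minimal_cover [WellQuasiOrderedLE P] {M : Type*} [AddCommGroup M] [Module k M]
    [FiniteDimensional k M] (Z : P → Submodule k M) (hZ : Monotone Z) :
    ∃ (r : ℕ) (deg : Fin r → P) (D : (Fin r → k) →ₗ[k] M),
      (∀ a, ∀ w ∈ strandBelow k deg a, D w ∈ Z a) ∧
      (∀ a, ∀ v ∈ Z a, ∃ w ∈ strandBelow k deg a, D w = v) ∧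
      ∀ a, ∀ w ∈ strandBelow k deg a, D w = 0 → ∀ b, deg b = a → w b = 0 := by
  classical
  let L (a : P) : Submodule k M := ⨆ a' < a, Z a'
  have hL : ∀ a, L a ≤ Z a := fun a => iSup₂_le fun a' h => hZ h.le
  have hLt : ∀ {a a'}, a' < a → Z a' ≤ L a := fun {a a'} h => le_iSup₂_of_le a' h le_rfl
  have hfin : {a | ¬ Z a ≤ L a}.Finite := finite_setOf_not_le_iSup_lt Z
  have := hfin.fintype
  choose C hC using fun a => Submodule.exists_isCompl (L a)
  -- `Q a` complements `L a` in `Z a`, by the modular law; its basis gives the new generators needed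
  -- in degree `a`.
  let Q (a : P) : Submodule k M := Z a ⊓ C a
  have hQ : ∀ a, Z a ≤ L a ⊔ Q a := by
    intro a
    have h : L a ⊔ C a ⊓ Z a = (L a ⊔ C a) ⊓ Z a := (sup_inf_assoc_of_le _ (hL a)).symm
    rw [(hC a).sup_eq_top, top_inf_eq, inf_comm] at h
    exact h.ge
  have hdisj : ∀ a, ∀ x ∈ L a, x ∈ Q a → x = 0 := fun a x hx hx' =>
    Submodule.disjoint_def.mp (hC a).disjoint x hx hx'.2
  let B (a : P) := Module.finBasis k (Q a)
  let κ := Σ a : {a | ¬ Z a ≤ L a}, Fin (Module.finrank k (Q a))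
  let x : κ → M := fun j => (B j.1 j.2 : M)
  suffices H : ∃ (D : (κ → k) →ₗ[k] M),
      (∀ a, ∀ w ∈ strandBelow k (fun j : κ => (j.1 : P)) a, D w ∈ Z a) ∧
      (∀ a, ∀ v ∈ Z a, ∃ w ∈ strandBelow k (fun j : κ => (j.1 : P)) a, D w = v) ∧
      ∀ a, ∀ w ∈ strandBelow k (fun j : κ => (j.1 : P)) a, D w = 0 →
        ∀ b : κ, (b.1 : P) = a → w b = 0 by
    obtain ⟨D, h1, h2, h3⟩ := H
    let e := Fintype.equivFin κ
    have hbelow : ∀ a (w : Fin (Fintype.card κ) → k),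
        w ∈ strandBelow k (fun b => ((e.symm b).1 : P)) a →
        w ∘ e ∈ strandBelow k (fun j : κ => (j.1 : P)) a := by
      intro a w hw j hj
      simpa using hw (e j) hj
    refine ⟨Fintype.card κ, fun b => (e.symm b).1, D ∘ₗ LinearMap.funLeft k k e,
      fun a w hw => h1 a _ (hbelow a w hw), fun a v hv => ?_, fun a w hw h0 b hb => ?_⟩
    · obtain ⟨w, hw, hDw⟩ := h2 a v hv
      refine ⟨w ∘ e.symm, fun b hb => hw _ hb, ?_⟩
      rw [← hDw, LinearMap.comp_apply]
      congr 1
      ext j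
      simp [LinearMap.funLeft_apply]
    · simpa using h3 a _ (hbelow a w hw) h0 (e.symm b) hb
  have hx : ∀ j : κ, x j ∈ Q j.1 := fun j => (B j.1 j.2).2
  refine ⟨Fintype.linearCombination k x, fun a w hw => ?_, fun a => ?_,
    fun a w hw h0 b hb => ?_⟩
  · rw [Fintype.linearCombination_apply]
    refine Submodule.sum_mem _ fun j _ => ?_
    by_cases hj : w j = 0
    · simp [hj]
    · exact Submodule.smul_mem _ _ (hZ (hw j hj) (hx j).1)
  · change Z a ≤ (strandBelow k (fun j : κ => (j.1 : P)) a).map (Fintype.linearCombination k x)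
    induction a using WellFoundedLT.induction with
    | ind a ih =>
    have hLa : L a ≤ (strandBelow k (fun j : κ => (j.1 : P)) a).map
        (Fintype.linearCombination k x) :=
      iSup₂_le fun a' h => (ih a' h).trans (Submodule.map_mono (strandBelow_mono _ h.le))
    by_cases ha : Z a ≤ L a
    · exact ha.trans hLa
    · refine (hQ a).trans (sup_le hLa fun q hq => ?_)
      have hsum := congrArg Subtype.val ((B a).sum_repr ⟨q, hq⟩)
      rw [AddSubmonoidClass.coe_finsetSum] at hsum
      change _ = q at hsum
      rw [← hsum]
      refine Submodule.sum_mem _ fun j _ => Submodule.smul_mem _ _ ?_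
      refine ⟨Pi.single (⟨⟨a, ha⟩, j⟩ : κ) 1, single_mem_strandBelow le_rfl 1, ?_⟩
      simp [Fintype.linearCombination_apply_single, x]
  · obtain ⟨⟨c, hc⟩, j⟩ := b
    obtain rfl : c = a := hb
    -- Split off the block of degree `c`. The other terms lie in `L c` and the block in `Q c`, so
    -- the block sums to zero and its basis coefficients vanish.
    rw [Fintype.linearCombination_apply, Fintype.sum_sigma,
      ← Finset.add_sum_erase _ _ (Finset.mem_univ (⟨c, hc⟩ : {a | ¬ Z a ≤ L a}))] at h0
    have hrest : ∑ a' ∈ Finset.univ.erase (⟨c, hc⟩ : {a | ¬ Z a ≤ L a}),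
        ∑ j, w ⟨a', j⟩ • x ⟨a', j⟩ ∈ L c := by
      refine Submodule.sum_mem _ fun a' ha' => Submodule.sum_mem _ fun j _ => ?_
      by_cases hj : w ⟨a', j⟩ = 0
      · simp [hj]
      · refine Submodule.smul_mem _ _ (hLt (lt_of_le_of_ne (hw _ hj) ?_) (hx ⟨a', j⟩).1)
        exact fun h => (Finset.mem_erase.mp ha').1 (Subtype.ext h)
    have hmain : ∑ j, w ⟨⟨c, hc⟩, j⟩ • x ⟨⟨c, hc⟩, j⟩ ∈ Q c :=
      Submodule.sum_mem _ fun j _ => Submodule.smul_mem _ _ (hx ⟨⟨c, hc⟩, j⟩)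
    have hzero : ∑ j, w ⟨⟨c, hc⟩, j⟩ • x ⟨⟨c, hc⟩, j⟩ = 0 := by
      refine hdisj c _ ?_ hmain
      rw [eq_neg_of_add_eq_zero_left h0]
      exact Submodule.neg_mem _ hrest
    have hB : ∑ j, w ⟨⟨c, hc⟩, j⟩ • B c j = 0 := by
      apply Subtype.ext
      rw [AddSubmonoidClass.coe_finsetSum]
      exact hzero
    exact Fintype.linearIndependent_iff.mp (B c).linearIndependent _ hB j

/-- A finitely generated free `P`-graded module together with a graded submodule which contains no
element having a generator with nonzero coefficient in its own degree. -/
structure MinimalSyzygyStage (k : Type*) [Field k] (P : Type*) [PartialOrder P] where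
  rank : ℕ
  deg : Fin rank → P
  syz : P → Submodule k (Fin rank → k)
  mono : Monotone syz
  le_below : ∀ a, syz a ≤ strandBelow k deg a
  apply_eq_zero : ∀ a, ∀ v ∈ syz a, ∀ b, deg b = a → v b = 0

namespace MinimalSyzygyStage

variable [WellQuasiOrderedLE P]

lemma exists_next {M : Type*} [AddCommGroup M] [Module k M]
    [FiniteDimensional k M] (Z : P → Submodule k M) (hZ : Monotone Z) :
    ∃ (s : MinimalSyzygyStage k P) (D : (Fin s.rank → k) →ₗ[k] M),
      (∀ a, ∀ w ∈ strandBelow k s.deg a, D w ∈ Z a) ∧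
      (∀ a, ∀ v ∈ Z a, ∃ w ∈ strandBelow k s.deg a, D w = v) ∧
      ∀ a w, w ∈ s.syz a ↔ w ∈ strandBelow k s.deg a ∧ D w = 0 := by
  obtain ⟨r, deg, D, h1, h2, h3⟩ := exists_minimal_cover Z hZ
  exact ⟨⟨r, deg, fun a => strandBelow k deg a ⊓ LinearMap.ker D,
    fun a b hab => inf_le_inf_right _ (strandBelow_mono deg hab), fun a => inf_le_left,
    fun a v hv b hb => h3 a v hv.1 hv.2 b hb⟩, D, h1, h2, fun a w => Iff.rfl⟩

/-- The next stage of a minimal resolution. -/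
noncomputable def next (s : MinimalSyzygyStage k P) : MinimalSyzygyStage k P :=
  (exists_next s.syz s.mono).choose

/-- The differential from the next stage. -/
noncomputable def d (s : MinimalSyzygyStage k P) : (Fin s.next.rank → k) →ₗ[k] (Fin s.rank → k) :=
  (exists_next s.syz s.mono).choose_spec.choose

lemma d_mem (s : MinimalSyzygyStage k P) (a : P) (w : Fin s.next.rank → k)
    (hw : w ∈ strandBelow k s.next.deg a) : s.d w ∈ s.syz a :=
  (exists_next s.syz s.mono).choose_spec.choose_spec.1 a w hw

lemma exists_d_eq (s : MinimalSyzygyStage k P) (a : P) (v : Fin s.rank → k) (hv : v ∈ s.syz a) :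
    ∃ w ∈ strandBelow k s.next.deg a, s.d w = v :=
  (exists_next s.syz s.mono).choose_spec.choose_spec.2.1 a v hv

lemma mem_syz_next (s : MinimalSyzygyStage k P) (a : P) (w : Fin s.next.rank → k) :
    w ∈ s.next.syz a ↔ w ∈ strandBelow k s.next.deg a ∧ s.d w = 0 :=
  (exists_next s.syz s.mono).choose_spec.choose_spec.2.2 a w

/-- Every basis vector lies in the strand of its own degree, so vanishing on strands gives vanishing
everywhere, although a vector need not lie in any one strand. -/
lemma apply_d_eq_zero (s : MinimalSyzygyStage k P) {X : Type*} [AddCommGroup X] [Module k X]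
    (D : (Fin s.rank → k) →ₗ[k] X) (hD : ∀ a, ∀ v ∈ s.syz a, D v = 0) (w : Fin s.next.rank → k) :
    D (s.d w) = 0 := by
  rw [← LinearMap.comp_apply, LinearMap.apply_eq_sum_smul_single]
  refine Finset.sum_eq_zero fun b _ => ?_
  rw [LinearMap.comp_apply, hD _ _ (s.d_mem _ _ (single_mem_strandBelow le_rfl 1)), smul_zero]

end MinimalSyzygyStage

/-- Over a well-quasi-ordered set of degrees, minimal resolutions of upper sets exist. -/
theorem StrandResolution.exists_isMinimal [WellQuasiOrderedLE P] {U : Set P} (hU : IsUpperSet U) :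
    ∃ (F : StrandResolution k U) (r : ℕ → ℕ), F.IsMinimal ∧ F.ι = fun i => Fin (r i) := by
  classical
  let Z (a : P) : Submodule k k := LinearMap.range (if a ∈ U then LinearMap.id else 0)
  have hZ : ∀ {a b}, a ≤ b → Z a ≤ Z b := by
    rintro a b hab _ ⟨x, rfl⟩
    by_cases ha : a ∈ U
    · exact ⟨x, by simp [ha, hU hab ha]⟩
    · exact ⟨0, by simp [ha]⟩
  obtain ⟨s₀, ε, hε, hε_surj, hs₀⟩ := MinimalSyzygyStage.exists_next (k := k)
    Z fun a b hab => hZ hab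
  let s (i : ℕ) : MinimalSyzygyStage k P := Nat.rec s₀ (fun _ t => t.next) i
  refine ⟨{
    ι := fun i => Fin (s i).rank
    finite := fun i => inferInstance
    deg := fun i => (s i).deg
    d := fun i => (s i).d
    ε := ε
    d_preserves := fun i a v hv => (s i).le_below a ((s i).d_mem a v hv)
    ε_eq_zero := fun a ha v hv => by
      obtain ⟨x, hx⟩ := hε a v hv
      simpa [ha] using hx.symm
    ε_surj := fun a ha => hε_surj a 1 ⟨1, by simp [ha]⟩
    ε_d := s₀.apply_d_eq_zero ε fun a v hv => ((hs₀ a v).mp hv).2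
    d_d := fun i => (s i).next.apply_d_eq_zero (s i).d fun a v hv =>
      (((s i).mem_syz_next a v).mp hv).2
    exact_zero := fun a v hv h0 => s₀.exists_d_eq a v ((hs₀ a v).mpr ⟨hv, h0⟩)
    exact_succ := fun i a v hv h0 =>
      (s i).next.exists_d_eq a v (((s i).mem_syz_next a v).mpr ⟨hv, h0⟩) },
    fun i => (s i).rank, ?_, rfl⟩
  exact fun i a v hv c hc => (s i).apply_eq_zero a _ ((s i).d_mem a v hv) c hc

end StrandResolutionExistence

/-! ### Translation between multigraded modules and scalar matrices. -/

section MultigradedModules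

open MvPolynomial

variable {k : Type*} [Field k] {V : Type*}

open Classical in
/-- The coefficients of the degree `a` part of an element of the free module with generators in
degrees `deg`. -/
noncomputable def strandCoeff {ι : Type*} (deg : ι → V →₀ ℕ) (a : V →₀ ℕ)
    (y : ι → MvPolynomial V k) (b : ι) : k :=
  if deg b ≤ a then coeff (a - deg b) (y b) else 0

/-- The element of degree `a` of the free module with generators in degrees `deg` which has the
given coefficients. -/
noncomputable def ofStrand {ι : Type*} (deg : ι → V →₀ ℕ) (a : V →₀ ℕ)
    (v : ι → k) (b : ι) : MvPolynomial V k :=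
  monomial (a - deg b) (v b)

section

variable {ι : Type*} {deg : ι → V →₀ ℕ} {a : V →₀ ℕ}

lemma strandCoeff_mem (y : ι → MvPolynomial V k) :
    strandCoeff deg a y ∈ strandBelow k deg a := by
  intro b hb
  by_contra h
  exact hb (if_neg h)

lemma strandCoeff_ofStrand {v : ι → k} (hv : v ∈ strandBelow k deg a) :
    strandCoeff deg a (ofStrand deg a v) = v := by
  classical
  ext b
  by_cases hb : deg b ≤ a
  · rw [strandCoeff, if_pos hb, ofStrand, coeff_monomial, if_pos rfl]
  · rw [strandCoeff, if_neg hb]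
    by_contra h
    exact hb (hv b (Ne.symm h))

/-- An element is the finite sum of its homogeneous components, so exactness can be checked degree
by degree. -/
lemma mem_of_forall_ofStrand_mem [Finite ι]
    (N : Submodule (MvPolynomial V k) (ι → MvPolynomial V k))
    (y : ι → MvPolynomial V k) (h : ∀ a, ofStrand deg a (strandCoeff deg a y) ∈ N) : y ∈ N := by
  classical
  have := Fintype.ofFinite ι
  let A : Finset (V →₀ ℕ) := Finset.univ.biUnion fun b => (y b).support.image (· + deg b)
  have hy : y = ∑ a ∈ A, ofStrand deg a (strandCoeff deg a y) := by
    ext b u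
    -- The coefficient of `x^u` at the generator `b` comes only from the component of degree `u +
    -- deg b`.
    rw [Finset.sum_apply, coeff_sum, Finset.sum_eq_single (u + deg b)]
    · simp [ofStrand, strandCoeff]
    · intro a _ ha
      rw [ofStrand, coeff_monomial]
      split_ifs with h1
      · rw [strandCoeff, if_neg]
        rintro h2
        exact ha (by rw [← h1, tsub_add_cancel_of_le h2])
      · rfl
    · intro hA
      have : coeff u (y b) = 0 := by
        by_contra hu
        exact hA (Finset.mem_biUnion.mpr ⟨b, Finset.mem_univ _,
          Finset.mem_image_of_mem _ (mem_support_iff.mpr hu)⟩)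
      simp [ofStrand, strandCoeff, this]
  rw [hy]
  exact Submodule.sum_mem _ fun a _ => h a

variable [Fintype ι] [DecidableEq ι] {e : V →₀ ℕ}
  {l : (ι → MvPolynomial V k) →ₗ[MvPolynomial V k] MvPolynomial V k} {m : (ι → k) →ₗ[k] k}

/-- Taking the degree `a` part turns `l` into `m`. The hypothesis `hm` ensures that truncated
subtraction is genuine wherever an entry is nonzero. -/
lemma coeff_apply_eq (hl : ∀ b, l (Pi.single b 1) = monomial (deg b - e) (m (Pi.single b 1)))
    (hm : ∀ b, m (Pi.single b 1) ≠ 0 → e ≤ deg b) (ha : e ≤ a) (y : ι → MvPolynomial V k) :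
    coeff (a - e) (l y) = m (strandCoeff deg a y) := by
  rw [LinearMap.apply_eq_sum_smul_single l, LinearMap.apply_eq_sum_smul_single m, coeff_sum]
  refine Finset.sum_congr rfl fun b _ => ?_
  rw [hl, smul_eq_mul, smul_eq_mul, coeff_mul_monomial', strandCoeff]
  by_cases h0 : m (Pi.single b 1) = 0
  · simp [h0]
  have he := hm b h0
  by_cases hb : deg b ≤ a
  · rw [if_pos (tsub_le_tsub_right hb e), if_pos hb, tsub_tsub_tsub_cancel_right he]
  · rw [if_neg, if_neg hb, zero_mul]
    intro h
    exact hb ((tsub_le_tsub_iff_right ha).mp h)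

lemma apply_ofStrand_eq (hl : ∀ b, l (Pi.single b 1) = monomial (deg b - e) (m (Pi.single b 1)))
    (hm : ∀ b, m (Pi.single b 1) ≠ 0 → e ≤ deg b) {v : ι → k} (hv : v ∈ strandBelow k deg a) :
    l (ofStrand deg a v) = monomial (a - e) (m v) := by
  rw [LinearMap.apply_eq_sum_smul_single l, LinearMap.apply_eq_sum_smul_single m, map_sum]
  refine Finset.sum_congr rfl fun b _ => ?_
  rw [hl, smul_eq_mul, smul_eq_mul, ofStrand, monomial_mul]
  by_cases h0 : m (Pi.single b 1) = 0
  · simp [h0]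
  by_cases h1 : v b = 0
  · simp [h1]
  rw [tsub_add_tsub_cancel (hv b h1) (hm b h0)]

end

/-- The map `δ` of free modules is homogeneous of degree zero with scalar matrix `D`. -/
structure HasScalarMatrix {ι κ : Type*} [DecidableEq ι] (deg : ι → V →₀ ℕ) (deg' : κ → V →₀ ℕ)
    (δ : (ι → MvPolynomial V k) →ₗ[MvPolynomial V k] (κ → MvPolynomial V k))
    (D : (ι → k) →ₗ[k] (κ → k)) : Prop where
  preserves : PreservesStrands deg deg' D
  apply_single : ∀ b c,
    δ (Pi.single b 1) c = monomial (deg b - deg' c) (D (Pi.single b 1) c)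

namespace HasScalarMatrix

variable {ι κ : Type*} [DecidableEq ι] {deg : ι → V →₀ ℕ} {deg' : κ → V →₀ ℕ}
  {δ : (ι → MvPolynomial V k) →ₗ[MvPolynomial V k] (κ → MvPolynomial V k)}
  {D : (ι → k) →ₗ[k] (κ → k)} {a : V →₀ ℕ}

lemma le_of_ne_zero (h : HasScalarMatrix deg deg' δ D) {b : ι} {c : κ}
    (hbc : D (Pi.single b 1) c ≠ 0) : deg' c ≤ deg b :=
  h.preserves _ _ (single_mem_strandBelow le_rfl 1) c hbc

variable [Fintype ι]

lemma strandCoeff_apply (h : HasScalarMatrix deg deg' δ D) (y : ι → MvPolynomial V k) :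
    strandCoeff deg' a (δ y) = D (strandCoeff deg a y) := by
  ext c
  by_cases hc : deg' c ≤ a
  · rw [strandCoeff, if_pos hc]
    exact coeff_apply_eq (l := LinearMap.proj c ∘ₗ δ) (m := LinearMap.proj c ∘ₗ D)
      (fun b => h.apply_single b c) (fun b hb => h.le_of_ne_zero hb) hc y
  · rw [strandCoeff, if_neg hc]
    by_contra h0
    exact hc (h.preserves a _ (strandCoeff_mem y) c (Ne.symm h0))

lemma apply_ofStrand (h : HasScalarMatrix deg deg' δ D) {v : ι → k}
    (hv : v ∈ strandBelow k deg a) : δ (ofStrand deg a v) = ofStrand deg' a (D v) := by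
  ext1 c
  exact apply_ofStrand_eq (l := LinearMap.proj c ∘ₗ δ) (m := LinearMap.proj c ∘ₗ D)
      (fun b => h.apply_single b c) (fun b hb => h.le_of_ne_zero hb) hv

end HasScalarMatrix

lemma eq_monomial_of_support {p : MvPolynomial V k} {e f : V →₀ ℕ}
    (h : ∀ u ∈ p.support, u + e = f) : p = monomial (f - e) (coeff (f - e) p) := by
  classical
  ext u
  rw [coeff_monomial]
  split_ifs with hu
  · rw [hu]
  · by_contra h0
    exact hu (by rw [← h u (mem_support_iff.mpr h0), add_tsub_cancel_right])

/-- The homogeneous map of free modules with a given scalar matrix. -/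
noncomputable def homogeneousMap {ι κ : Type*} [Fintype ι] [DecidableEq ι] (deg : ι → V →₀ ℕ)
    (deg' : κ → V →₀ ℕ) (D : (ι → k) →ₗ[k] (κ → k)) :
    (ι → MvPolynomial V k) →ₗ[MvPolynomial V k] (κ → MvPolynomial V k) :=
  LinearMap.pi fun c => Fintype.linearCombination (MvPolynomial V k)
    fun b => monomial (deg b - deg' c) (D (Pi.single b 1) c)

lemma hasScalarMatrix_homogeneousMap {ι κ : Type*} [Fintype ι] [DecidableEq ι]
    {deg : ι → V →₀ ℕ} {deg' : κ → V →₀ ℕ} {D : (ι → k) →ₗ[k] (κ → k)}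
    (hD : PreservesStrands deg deg' D) :
    HasScalarMatrix deg deg' (homogeneousMap deg deg' D) D :=
  ⟨hD, fun b c => by simp [homogeneousMap, Fintype.linearCombination_apply_single]⟩

lemma exists_hasScalarMatrix {ι κ : Type*} [Fintype ι] [DecidableEq ι]
    {deg : ι → V →₀ ℕ} {deg' : κ → V →₀ ℕ}
    {δ : (ι → MvPolynomial V k) →ₗ[MvPolynomial V k] (κ → MvPolynomial V k)}
    (h : ∀ b c, ∀ u ∈ (δ (Pi.single b 1) c).support, u + deg' c = deg b) :
    ∃ D : (ι → k) →ₗ[k] (κ → k), HasScalarMatrix deg deg' δ D := by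
  let D : (ι → k) →ₗ[k] (κ → k) := LinearMap.pi fun c => Fintype.linearCombination k
    fun b => coeff (deg b - deg' c) (δ (Pi.single b 1) c)
  refine ⟨D, fun a v hv c hc => ?_, fun b c => ?_⟩
  · obtain ⟨b, -, hb⟩ := Finset.exists_ne_zero_of_sum_ne_zero
      (show ∑ b, v b • coeff (deg b - deg' c) (δ (Pi.single b 1) c) ≠ 0 from hc)
    simp only [smul_eq_mul, ne_eq, mul_eq_zero, not_or] at hb
    refine le_trans ?_ (hv b hb.1)
    rw [← h b c _ (mem_support_iff.mpr hb.2)]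
    exact le_add_self
  · have hD : D (Pi.single b 1) c = coeff (deg b - deg' c) (δ (Pi.single b 1) c) := by
      simp [D, Fintype.linearCombination_apply_single]
    rw [hD]
    exact eq_monomial_of_support (h b c)

/-- A minimal multigraded free resolution of an ideal yields a minimal resolution in terms of
scalar matrices, with the same generators. -/
lemma MinimalMultigradedFreeResolution.exists_strandResolution {I : Ideal (MvPolynomial V k)}
    (F : MinimalMultigradedFreeResolution I) :
    ∃ R : StrandResolution k {u | monomial u (1 : k) ∈ I}, R.IsMinimal ∧
      ∀ i a, Nat.card {b // R.deg i b = a} = Nat.card {b // F.deg i b = a} := by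
  classical
  choose D hD using fun i => exists_hasScalarMatrix (F.d_homogeneous i)
  let ε : (Fin (F.rank 0) → k) →ₗ[k] k := Fintype.linearCombination k
    fun b => coeff (F.deg 0 b) (F.aug (Pi.single b 1))
  have hε : ∀ b, F.aug (Pi.single b 1) = monomial (F.deg 0 b - 0) (ε (Pi.single b 1)) := by
    intro b
    have h1 : ε (Pi.single b 1) = coeff (F.deg 0 b) (F.aug (Pi.single b 1)) := by
      simp [ε, Fintype.linearCombination_apply_single]
    have h2 := eq_monomial_of_support (e := 0) (f := F.deg 0 b)
      (fun u hu => (add_zero u).trans (F.aug_homogeneous b u hu))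
    rw [h1]
    rwa [tsub_zero] at h2 ⊢
  have hcoeff : ∀ a y, coeff a (F.aug y) = ε (strandCoeff (F.deg 0) a y) := by
    intro a y
    simpa using coeff_apply_eq hε (fun b _ => zero_le) (zero_le (a := a)) y
  have haug : ∀ a v, v ∈ strandBelow k (F.deg 0) a →
      F.aug (ofStrand (F.deg 0) a v) = monomial a (ε v) := by
    intro a v hv
    simpa using apply_ofStrand_eq hε (fun b _ => zero_le) hv
  have hlin : ∀ {r : ℕ} (deg : Fin r → V →₀ ℕ) {X : Type _} [AddCommGroup X] [Module k X]
      (f : (Fin r → k) →ₗ[k] X), (∀ a, ∀ v ∈ strandBelow k deg a, f v = 0) → ∀ v, f v = 0 := by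
    intro r deg X _ _ f hf v
    rw [LinearMap.apply_eq_sum_smul_single]
    exact Finset.sum_eq_zero fun b _ => by
      rw [hf (deg b) _ (single_mem_strandBelow le_rfl 1), smul_zero]
  refine ⟨{
    ι := fun i => Fin (F.rank i)
    finite := fun i => inferInstance
    deg := F.deg
    d := D
    ε := ε
    d_preserves := fun i => (hD i).preserves
    ε_eq_zero := fun a ha v hv => by
      by_contra h0
      refine ha ?_
      have h1 := LinearMap.mem_range_self F.aug (ofStrand (F.deg 0) a v)
      rw [F.range_aug, haug a v hv] at h1
      have h2 := I.mul_mem_left (C (ε v)⁻¹) h1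
      rwa [C_mul_monomial, inv_mul_cancel₀ h0] at h2
    ε_surj := fun a ha => by
      have h1 : monomial a (1 : k) ∈ LinearMap.range F.aug := F.range_aug.symm ▸ ha
      obtain ⟨y, hy⟩ := h1
      exact ⟨strandCoeff (F.deg 0) a y, strandCoeff_mem y, by
        rw [← hcoeff, hy, coeff_monomial, if_pos rfl]⟩
    ε_d := hlin (F.deg 1) (ε ∘ₗ D 0) fun a v hv => by
      have h1 : F.d 0 (ofStrand (F.deg 1) a v) ∈ LinearMap.ker F.aug :=
        F.exact_zero ▸ LinearMap.mem_range_self _ _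
      rw [(hD 0).apply_ofStrand hv, LinearMap.mem_ker,
        haug _ _ ((hD 0).preserves a v hv)] at h1
      exact monomial_eq_zero.mp h1
    d_d := fun i => hlin (F.deg (i + 2)) (D i ∘ₗ D (i + 1)) fun a v hv => by
      have h1 : F.d (i + 1) (ofStrand (F.deg (i + 2)) a v) ∈ LinearMap.ker (F.d i) :=
        F.exact_succ i ▸ LinearMap.mem_range_self _ _
      rw [LinearMap.mem_ker] at h1
      have h2 := congrArg (strandCoeff (F.deg i) a) h1
      rw [(hD i).strandCoeff_apply, (hD (i + 1)).strandCoeff_apply,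
        strandCoeff_ofStrand hv] at h2
      rw [LinearMap.comp_apply, h2]
      ext c
      simp [strandCoeff]
    exact_zero := fun a v hv h0 => by
      have h1 : ofStrand (F.deg 0) a v ∈ LinearMap.ker F.aug := by
        rw [LinearMap.mem_ker, haug a v hv, h0, monomial_zero]
      rw [F.exact_zero] at h1
      obtain ⟨y, hy⟩ := h1
      exact ⟨strandCoeff (F.deg 1) a y, strandCoeff_mem y, by
        rw [← (hD 0).strandCoeff_apply, hy, strandCoeff_ofStrand hv]⟩
    exact_succ := fun i a v hv h0 => by
      have h1 : ofStrand (F.deg (i + 1)) a v ∈ LinearMap.ker (F.d i) := by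
        rw [LinearMap.mem_ker, (hD i).apply_ofStrand hv, h0]
        ext c
        simp [ofStrand]
      rw [F.exact_succ] at h1
      obtain ⟨y, hy⟩ := h1
      exact ⟨strandCoeff (F.deg (i + 2)) a y, strandCoeff_mem y, by
        rw [← (hD (i + 1)).strandCoeff_apply, hy, strandCoeff_ofStrand hv]⟩ }, ?_,
    fun i a => rfl⟩
  intro i a v hv c hc
  change D i v c = 0
  rw [LinearMap.apply_eq_sum_smul_single (D i), Finset.sum_apply]
  refine Finset.sum_eq_zero fun b _ => ?_
  by_cases hb : v b = 0
  · simp [hb]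
  -- As `deg b ≤ a = deg c`, this entry of the differential is a constant, and the ideal of the
  -- variables contains no nonzero constant.
  have h0 : D i (Pi.single b 1) c = 0 := by
    by_contra hbc
    have hdeg : F.deg (i + 1) b - F.deg i c = 0 :=
      tsub_eq_zero_of_le ((hv b hb).trans (le_of_eq (Eq.symm hc)))
    have h1 := F.minimal i (Pi.single b 1) c
    rw [(hD i).apply_single, hdeg, ← Set.image_univ, mem_ideal_span_X_image] at h1
    obtain ⟨j, -, hj⟩ := h1 0 (by simpa [mem_support_iff] using hbc)
    exact hj rfl
  simp [h0]

/-- Minimal multigraded free resolutions of monomial ideals exist. -/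
theorem nonempty_minimalMultigradedFreeResolution [Finite V] {I : Ideal (MvPolynomial V k)}
    (hI : ∀ p ∈ I, ∀ u ∈ p.support, monomial u (1 : k) ∈ I) :
    Nonempty (MinimalMultigradedFreeResolution I) := by
  classical
  have hU : IsUpperSet {u | monomial u (1 : k) ∈ I} := by
    intro u w huw hu
    have h := I.mul_mem_left (monomial (w - u) 1) hu
    rwa [monomial_mul, one_mul, tsub_add_cancel_of_le huw] at h
  obtain ⟨⟨ι, _, deg, d, ε, d_pres, ε_zero, ε_surj, ε_d, d_d, ex_zero, ex_succ⟩, r, hmin, hr⟩ :=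
    StrandResolution.exists_isMinimal (k := k) hU
  dsimp only at hr
  subst hr
  have hδ := fun i => hasScalarMatrix_homogeneousMap (d_pres i)
  let δ (i : ℕ) := homogeneousMap (deg (i + 1)) (deg i) (d i)
  let aug : (Fin (r 0) → MvPolynomial V k) →ₗ[MvPolynomial V k] MvPolynomial V k :=
    Fintype.linearCombination (MvPolynomial V k) fun b => monomial (deg 0 b) (ε (Pi.single b 1))
  have haug_single : ∀ b, aug (Pi.single b 1) = monomial (deg 0 b) (ε (Pi.single b 1)) := by
    intro b
    simp [aug, Fintype.linearCombination_apply_single]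
  have hε : ∀ b, aug (Pi.single b 1) = monomial (deg 0 b - 0) (ε (Pi.single b 1)) := by
    simpa using haug_single
  have hcoeff : ∀ a y, coeff a (aug y) = ε (strandCoeff (deg 0) a y) := by
    intro a y
    simpa using coeff_apply_eq hε (fun b _ => zero_le) (zero_le (a := a)) y
  have haug : ∀ a v, v ∈ strandBelow k (deg 0) a →
      aug (ofStrand (deg 0) a v) = monomial a (ε v) := by
    intro a v hv
    simpa using apply_ofStrand_eq hε (fun b _ => zero_le) hv
  refine ⟨{
    rank := r
    deg := deg
    d := δ
    aug := aug
    d_homogeneous := fun i b c u hu => by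
      rw [(hδ i).apply_single, mem_support_iff, coeff_monomial] at hu
      split_ifs at hu with h
      · rw [← h, tsub_add_cancel_of_le ((hδ i).le_of_ne_zero hu)]
      · exact absurd rfl hu
    aug_homogeneous := fun b u hu => by
      rw [haug_single, mem_support_iff, coeff_monomial] at hu
      split_ifs at hu with h
      · exact h.symm
      · exact absurd rfl hu
    range_aug := ?_
    exact_zero := ?_
    exact_succ := fun i => ?_
    minimal := fun i x c => ?_ }⟩
  · refine le_antisymm ?_ fun p hp => ?_
    · rintro _ ⟨y, rfl⟩
      rw [(aug y).as_sum]
      refine Submodule.sum_mem _ fun a ha => ?_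
      have hmem : monomial a (1 : k) ∈ I := by
        by_contra h
        rw [mem_support_iff, hcoeff] at ha
        exact ha (ε_zero a h _ (strandCoeff_mem y))
      have h := I.mul_mem_left (C (coeff a (aug y))) hmem
      rwa [C_mul_monomial, mul_one] at h
    · rw [p.as_sum]
      refine Submodule.sum_mem _ fun a ha => ?_
      obtain ⟨v, hv, hv1⟩ := ε_surj a (hI p hp a ha)
      have h := Submodule.smul_mem (LinearMap.range aug) (C (coeff a p))
        (LinearMap.mem_range_self aug (ofStrand (deg 0) a v))
      rwa [haug a v hv, hv1, smul_eq_mul, C_mul_monomial, mul_one] at h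
  · refine le_antisymm (fun y hy => mem_of_forall_ofStrand_mem (deg := deg 0) _ y fun a => ?_) ?_
    · obtain ⟨w, hw, hwy⟩ := ex_zero a (strandCoeff (deg 0) a y) (strandCoeff_mem y)
        (by rw [← hcoeff, LinearMap.mem_ker.mp hy, coeff_zero])
      exact ⟨ofStrand (deg 1) a w, by rw [(hδ 0).apply_ofStrand hw, hwy]⟩
    · rintro _ ⟨y, rfl⟩
      rw [LinearMap.mem_ker]
      ext a
      rw [hcoeff, (hδ 0).strandCoeff_apply, ε_d, coeff_zero]
  · refine le_antisymm
      (fun y hy => mem_of_forall_ofStrand_mem (deg := deg (i + 1)) _ y fun a => ?_) ?_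
    · obtain ⟨w, hw, hwy⟩ := ex_succ i a (strandCoeff (deg (i + 1)) a y) (strandCoeff_mem y) (by
        rw [← (hδ i).strandCoeff_apply, LinearMap.mem_ker.mp hy]
        ext c
        simp [strandCoeff])
      exact ⟨ofStrand (deg (i + 2)) a w, by rw [(hδ (i + 1)).apply_ofStrand hw, hwy]⟩
    · rintro _ ⟨y, rfl⟩
      rw [LinearMap.mem_ker, ← Submodule.mem_bot (MvPolynomial V k)]
      refine mem_of_forall_ofStrand_mem (deg := deg i) ⊥ _ fun a => ?_
      rw [(hδ i).strandCoeff_apply, (hδ (i + 1)).strandCoeff_apply, d_d, Submodule.mem_bot]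
      ext c
      simp [ofStrand]
  · rw [LinearMap.apply_eq_sum_smul_single (δ i), Finset.sum_apply]
    refine Submodule.sum_mem _ fun b _ => ?_
    rw [Pi.smul_apply, smul_eq_mul, (hδ i).apply_single]
    refine Ideal.mul_mem_left _ _ ?_
    rw [← Set.image_univ, mem_ideal_span_X_image]
    intro u hu
    rw [mem_support_iff, coeff_monomial] at hu
    split_ifs at hu with h
    -- An entry outside the ideal of the variables would have exponent zero, hence `deg b ≤ deg c`;
    -- minimality makes its scalar vanish.
    · by_contra! h0
      have hu0 : deg (i + 1) b ≤ deg i c :=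
        tsub_eq_zero_iff_le.mp (h.trans (Finsupp.ext fun j => h0 j (Set.mem_univ j)))
      exact hu (hmin i (deg i c) _ (single_mem_strandBelow hu0 1) c rfl)
    · exact absurd rfl hu

end MultigradedModules

/-! ### Comparison of Betti numbers. -/

section BettiNumbers

open MvPolynomial

variable {k : Type*} [Field k] {V : Type*}

/-- Injections chosen fibre by fibre glue to one injection over `α`; this passes from multidegrees
to total degrees. -/
lemma card_subtype_comp_le {α ι κ : Type*} [Finite ι] [Finite κ] {f : ι → α} {g : κ → α}
    (h : ∀ a, Nat.card {b // f b = a} ≤ Nat.card {b // g b = a}) (p : α → Prop) :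
    Nat.card {b // p (f b)} ≤ Nat.card {b // p (g b)} := by
  have he : ∀ a, Nonempty ({b // f b = a} ↪ {b // g b = a}) := by
    intro a
    have := Fintype.ofFinite {b // f b = a}
    have := Fintype.ofFinite {b // g b = a}
    rw [Function.Embedding.nonempty_iff_card_le]
    simpa [Nat.card_eq_fintype_card] using h a
  let φ (b : ι) : {c // g c = f b} := (he (f b)).some ⟨b, rfl⟩
  refine Nat.card_le_card_of_injective (β := {b // p (g b)})
    (fun b => ⟨φ b.1, by rw [(φ b.1).2]; exact b.2⟩) fun b c hbc => ?_
  have h1 : (φ b.1 : κ) = φ c.1 := congrArg Subtype.val hbc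
  have h2 : f b.1 = f c.1 := by rw [← (φ b.1).2, h1, (φ c.1).2]
  have h3 : ∀ {a a'} (_ : a = a') (x : {b // f b = a}) (y : {b // f b = a'}),
      ((he a).some x : κ) = (he a').some y → (x : ι) = y := by
    rintro a _ rfl x y hxy
    exact congrArg Subtype.val ((he a).some.injective (Subtype.ext hxy))
  exact Subtype.ext (h3 h2 ⟨b.1, rfl⟩ ⟨c.1, rfl⟩ h1)

/-- If `ρ` is an interior operator on multidegrees with lower set of fixed points, and the
monomials in `J` are those whose multidegree is mapped by `ρ` to that of a monomial in `I`, then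
every minimal resolution of `J` has at most as many generators in each multidegree as one
of `I`. -/
lemma MinimalMultigradedFreeResolution.card_le_of_restrict {I J : Ideal (MvPolynomial V k)}
    (F : MinimalMultigradedFreeResolution I) (F' : MinimalMultigradedFreeResolution J)
    (ρ : (V →₀ ℕ) → V →₀ ℕ) (hmono : Monotone ρ) (hle : ∀ a, ρ a ≤ a)
    (hlower : ∀ a b, a ≤ ρ b → ρ a = a)
    (hρ : ∀ u, monomial u (1 : k) ∈ J ↔ monomial (ρ u) (1 : k) ∈ I) (i : ℕ) (a : V →₀ ℕ) :
    Nat.card {b // F'.deg i b = a} ≤ Nat.card {b // F.deg i b = a} := by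
  obtain ⟨R, -, hR⟩ := F.exists_strandResolution
  obtain ⟨R', hmin, hR'⟩ := F'.exists_strandResolution
  have hU : {u | monomial u (1 : k) ∈ J} = ρ ⁻¹' {u | monomial u (1 : k) ∈ I} :=
    Set.ext hρ
  -- The type of `R'` depends on the set being rewritten.
  revert R'
  rw [hU]
  intro R' hmin hR'
  rw [← hR, ← hR']
  exact (R'.card_fiber_le (R.restrict ρ hmono hle hlower) hmin i a).trans
    (R.card_fiber_restrict_le ρ hmono hle hlower i a)

/-! ### Monomials in symbolic powers of edge ideals. -/

/-- The weight is the degree in the variables of `C`. A monomial of positive weight is divisible by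
such a variable, which can be split off inductively. -/
lemma mem_span_X_image_pow_iff {C : Set V} {n : ℕ} {p : MvPolynomial V k} :
    p ∈ Ideal.span ((X : V → MvPolynomial V k) '' C) ^ n ↔
      ∀ u ∈ p.support, n ≤ Finsupp.weight (C.indicator 1) u := by
  classical
  have hmono : ∀ {u v : V →₀ ℕ}, u ≤ v →
      Finsupp.weight (C.indicator 1) u ≤ Finsupp.weight (C.indicator (1 : V → ℕ)) v := by
    intro u v h
    rw [← tsub_add_cancel_of_le h, map_add]
    exact le_add_self
  have key : Ideal.span ((X : V → MvPolynomial V k) '' C) ^ n =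
      Ideal.span ((fun u => monomial u (1 : k)) ''
        {u | n ≤ Finsupp.weight (C.indicator (1 : V → ℕ)) u}) := by
    induction n with
    | zero =>
      rw [pow_zero, Ideal.one_eq_top, eq_comm, Ideal.eq_top_iff_one]
      exact Ideal.subset_span ⟨0, by simp, rfl⟩
    | succ n ih =>
      rw [pow_succ, ih, Ideal.span_mul_span']
      refine le_antisymm (Ideal.span_le.mpr ?_) (Ideal.span_le.mpr ?_)
      · rintro _ ⟨_, ⟨u, hu, rfl⟩, _, ⟨j, hj, rfl⟩, rfl⟩
        refine Ideal.subset_span ⟨u + Finsupp.single j 1, ?_, ?_⟩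
        · simpa [Finsupp.weight_single, hj] using hu
        · simp [X, monomial_mul]
      · rintro _ ⟨u, hu, rfl⟩
        have hne : Finsupp.weight (C.indicator (1 : V → ℕ)) u ≠ 0 := by
          have : n + 1 ≤ Finsupp.weight (C.indicator (1 : V → ℕ)) u := hu
          omega
        rw [Finsupp.weight_apply] at hne
        obtain ⟨j, hj, hj0⟩ := Finset.exists_ne_zero_of_sum_ne_zero hne
        have hjC : j ∈ C := by
          by_contra h
          simp [h] at hj0
        have hju : Finsupp.single j 1 ≤ u := by
          rw [Finsupp.single_le_iff]
          exact Nat.one_le_iff_ne_zero.mpr (Finsupp.mem_support_iff.mp hj)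
        refine Ideal.subset_span ⟨_, ⟨u - Finsupp.single j 1, ?_, rfl⟩, _, ⟨j, hjC, rfl⟩, ?_⟩
        · have h1 : n + 1 ≤ Finsupp.weight (C.indicator (1 : V → ℕ)) u := hu
          rw [← tsub_add_cancel_of_le hju, map_add] at h1
          simpa [Finsupp.weight_single, hjC] using h1
        · simp only [X, monomial_mul, mul_one]
          rw [tsub_add_cancel_of_le hju]
  rw [key, mem_ideal_span_monomial_image]
  refine forall₂_congr fun u _ => ⟨?_, fun h => ⟨u, h, le_rfl⟩⟩
  rintro ⟨v, hv, hvu⟩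
  exact le_trans hv (hmono hvu)

lemma mem_edgeIdealSymbolicPower_iff {G : SimpleGraph V} {n : ℕ} {p : MvPolynomial V k} :
    p ∈ edgeIdealSymbolicPower k G n ↔ ∀ C, Minimal G.IsVertexCover C →
      ∀ u ∈ p.support, n ≤ Finsupp.weight (C.indicator 1) u := by
  simp only [edgeIdealSymbolicPower, Submodule.mem_iInf, mem_span_X_image_pow_iff]

/-- Every cover contains a minimal one, and the weight grows with the cover. Dropping minimality
matters because intersecting with `V(H)` or adding its complement need not preserve it. -/
lemma monomial_mem_edgeIdealSymbolicPower_iff [Finite V] {G : SimpleGraph V} {n : ℕ}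
    {u : V →₀ ℕ} :
    monomial u (1 : k) ∈ edgeIdealSymbolicPower k G n ↔
      ∀ C, G.IsVertexCover C → n ≤ Finsupp.weight (C.indicator 1) u := by
  classical
  have := Fintype.ofFinite V
  rw [mem_edgeIdealSymbolicPower_iff]
  simp only [support_monomial, one_ne_zero, if_false, Finset.mem_singleton, forall_eq]
  refine ⟨fun h C hC => ?_, fun h C hC => h C hC.prop⟩
  obtain ⟨D, hDC, hD⟩ := exists_minimal_le_of_wellFoundedLT G.IsVertexCover C hC
  refine (h D hD).trans ?_
  rw [Finsupp.weight_eq_sum, Finsupp.weight_eq_sum]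
  refine Finset.sum_le_sum fun v _ => Nat.mul_le_mul_left _ ?_
  exact Set.indicator_le_indicator_of_subset hDC (fun _ => zero_le_one) v

open Classical in
lemma monomial_mem_edgeIdealSymbolicPower_spanningCoe_iff [Finite V] {G : SimpleGraph V}
    {H : G.Subgraph} (hH : H.IsInduced) {n : ℕ} {u : V →₀ ℕ} :
    monomial u (1 : k) ∈ edgeIdealSymbolicPower k H.spanningCoe n ↔
      monomial (u.filter (· ∈ H.verts)) (1 : k) ∈ edgeIdealSymbolicPower k G n := by
  have := Fintype.ofFinite V
  have hweight : ∀ C : Set V, Finsupp.weight (C.indicator (1 : V → ℕ)) (u.filter (· ∈ H.verts)) =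
      Finsupp.weight ((C ∩ H.verts).indicator (1 : V → ℕ)) u := by
    intro C
    rw [Finsupp.weight_eq_sum, Finsupp.weight_eq_sum]
    refine Finset.sum_congr rfl fun v _ => ?_
    by_cases hC : v ∈ C <;> by_cases hv : v ∈ H.verts <;> simp [hC, hv]
  rw [monomial_mem_edgeIdealSymbolicPower_iff, monomial_mem_edgeIdealSymbolicPower_iff]
  refine ⟨fun h C hC => ?_, fun h C hC => ?_⟩
  · rw [hweight]
    refine h _ fun v w hvw => ?_
    have hvw' : H.Adj v w := hvw
    exact (hC hvw'.adj_sub).imp (fun h => ⟨h, H.edge_vert hvw'⟩)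
      fun h => ⟨h, H.edge_vert hvw'.symm⟩
  -- Edges of `G` inside `V(H)` are edges of `H` since `H` is induced; all others meet the
  -- complement.
  · have hcover : G.IsVertexCover (C ∪ H.vertsᶜ) := by
      intro v w hvw
      by_cases hv : v ∈ H.verts
      · by_cases hw : w ∈ H.verts
        · exact (hC (show H.spanningCoe.Adj v w from hH hv hw hvw)).imp Or.inl Or.inl
        · exact Or.inr (Or.inr hw)
      · exact Or.inl (Or.inr hv)
    refine (h _ hcover).trans ?_
    rw [hweight, Finsupp.weight_eq_sum, Finsupp.weight_eq_sum]
    refine Finset.sum_le_sum fun v _ => Nat.mul_le_mul_left _ ?_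
    refine Set.indicator_le_indicator_of_subset ?_ (fun _ => zero_le_one) v
    rintro w ⟨hw | hw, hw'⟩
    · exact hw
    · exact absurd hw' hw

lemma nonempty_minimalMultigradedFreeResolution_edgeIdealSymbolicPower [Finite V]
    (G : SimpleGraph V) (n : ℕ) :
    Nonempty (MinimalMultigradedFreeResolution (edgeIdealSymbolicPower k G n)) := by
  classical
  refine nonempty_minimalMultigradedFreeResolution fun p hp u hu => ?_
  rw [mem_edgeIdealSymbolicPower_iff] at hp ⊢
  simpa [support_monomial] using fun C hC => hp C hC u hu

lemma card_fiber_le_of_isInduced [Finite V] {G : SimpleGraph V} {H : G.Subgraph}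
    (hH : H.IsInduced) {n : ℕ}
    (F : MinimalMultigradedFreeResolution (edgeIdealSymbolicPower k G n))
    (F' : MinimalMultigradedFreeResolution (edgeIdealSymbolicPower k H.spanningCoe n))
    (i : ℕ) (a : V →₀ ℕ) :
    Nat.card {b // F'.deg i b = a} ≤ Nat.card {b // F.deg i b = a} := by
  classical
  refine F.card_le_of_restrict F' (fun u => u.filter (· ∈ H.verts)) (fun u v h j => ?_)
    (fun u j => ?_) (fun u v h => ?_)
    (fun u => monomial_mem_edgeIdealSymbolicPower_spanningCoe_iff hH) i a
  · by_cases hj : j ∈ H.verts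
    · simpa [hj] using h j
    · simp [hj]
  · by_cases hj : j ∈ H.verts <;> simp [hj]
  · ext j
    by_cases hj : j ∈ H.verts
    · simp [hj]
    · have := h j
      simp only [Finsupp.filter_apply, hj, if_false] at this ⊢
      omega

lemma gradedBetti_le_of_isInduced [Finite V] {G : SimpleGraph V} {H : G.Subgraph}
    (hH : H.IsInduced) (n i j : ℕ) :
    gradedBetti (edgeIdealSymbolicPower k H.spanningCoe n) i j ≤
      gradedBetti (edgeIdealSymbolicPower k G n) i j := by
  have hG := nonempty_minimalMultigradedFreeResolution_edgeIdealSymbolicPower (k := k) G n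
  have hH' := nonempty_minimalMultigradedFreeResolution_edgeIdealSymbolicPower (k := k)
    H.spanningCoe n
  rw [gradedBetti, gradedBetti, dif_pos hG, dif_pos hH']
  rw [← Nat.card_eq_fintype_card, ← Nat.card_eq_fintype_card]
  exact card_subtype_comp_le
    (card_fiber_le_of_isInduced hH hG.some hH'.some i) fun a => a.degree = j

lemma multigradedBetti_le_of_isInduced [Finite V] {G : SimpleGraph V} {H : G.Subgraph}
    (hH : H.IsInduced) (n i : ℕ) (a : V →₀ ℕ) :
    multigradedBetti (edgeIdealSymbolicPower k H.spanningCoe n) i a ≤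
      multigradedBetti (edgeIdealSymbolicPower k G n) i a := by
  classical
  have hG := nonempty_minimalMultigradedFreeResolution_edgeIdealSymbolicPower (k := k) G n
  have hH' := nonempty_minimalMultigradedFreeResolution_edgeIdealSymbolicPower (k := k)
    H.spanningCoe n
  rw [multigradedBetti, multigradedBetti, dif_pos hG, dif_pos hH']
  rw [← Nat.card_eq_fintype_card, ← Nat.card_eq_fintype_card]
  exact card_fiber_le_of_isInduced hH hG.some hH'.some i a

end BettiNumbers

theorem corollary4p7 {k : Type*} [Field k] {V : Type*} [Finite V]
    (G : SimpleGraph V) (H : G.Subgraph) (hH : H.IsInduced) (n : ℕ) (hn : 1 ≤ n) :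
    (∀ (i : ℕ) (a : V →₀ ℕ),
      multigradedBetti (edgeIdealSymbolicPower k H.spanningCoe n) i a ≤
        multigradedBetti (edgeIdealSymbolicPower k G n) i a) ∧
    (∀ i j : ℕ,
      gradedBetti (edgeIdealSymbolicPower k H.spanningCoe n) i j ≤
        gradedBetti (edgeIdealSymbolicPower k G n) i j) ∧
    castelnuovoMumfordReg (edgeIdealSymbolicPower k H.spanningCoe n) ≤
      castelnuovoMumfordReg (edgeIdealSymbolicPower k G n) := by
  refine ⟨multigradedBetti_le_of_isInduced hH n, gradedBetti_le_of_isInduced hH n, ?_⟩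
  -- The supremum for `G` runs over at least the pairs `(i, j)` occurring for `H`.
  refine iSup_mono fun i => iSup_mono fun j => iSup_const_mono fun h => ?_
  exact ((Nat.pos_of_ne_zero h).trans_le (gradedBetti_le_of_isInduced hH n i j)).ne'
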